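/- Let $R$ be a Gorenstein local ring of Krull dimension $1$, that is, a commutative Noetherian local ring of Krull dimension $1$ that has finite injective dimension as a module over itself. Let $Q(R)$ be the total ring of fractions of $R$ (the localization of $R$ at the set of all its non-zero-divisors), and let $R\subseteq S\subseteq Q(R)$ be a finite birational extension, that is, $S$ is a subring of $Q(R)$ which contains $R$ and is finitely generated as an $R$-module. Let $\mathfrak c_R(S)=(R:_{Q(R)}S)=\{a\in Q(R): aS\subseteq R\}$ be the conductor of $S$ in $R$, which is an ideal of $R$. Then the following are equivalent: 1. $S$ is a Gorenstein ring, that is, $S$ is Noetherian and for every maximal ideal $\mathfrak m$ of $S$ the local ring $S_{\mathfrak m}$ has finite injective dimension as a module over itself; 2. $S\cong \operatorname{Hom}_R(S,R)$ as $R$-modules; 3. $\mathfrak c_R(S)$ is a stable ideal of $R$, that is, $\mathfrak c_R(S)$ contains a non-zero-divisor of $R$ and $\mathfrak c_R(S)\cong\operatorname{Hom}_R(\mathfrak c_R(S),\mathfrak c_R(S))$ as $R$-modules. -/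

import Mathlib

open CategoryTheory

universe u v

/-- A Gorenstein local ring: a Noetherian local ring that has finite injective dimension as a
module over itself. -/
structure IsGorensteinLocalRing (R : Type u) [CommRing R] : Prop where
  isLocalRing : IsLocalRing R
  isNoetherianRing : IsNoetherianRing R
  finite_injectiveDimension : ∃ n : ℕ, HasInjectiveDimensionLE (ModuleCat.of R R) n

/-- A (not necessarily local) Gorenstein ring: a Noetherian ring all of whose localizations at
maximal ideals are Gorenstein local rings. -/
structure IsGorensteinRing (A : Type u) [CommRing A] : Prop where
  isNoetherianRing : IsNoetherianRing A
  localization (m : Ideal A) [m.IsMaximal] : IsGorensteinLocalRing (Localization.AtPrime m)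

/-- A stable ideal: an ideal `I` that contains a non-zero-divisor and is isomorphic, as an
`R`-module, to `Hom_R(I, I)`. -/
structure IsStableIdeal {R : Type u} [CommRing R] (I : Ideal R) : Prop where
  regular : ∃ x ∈ I, x ∈ nonZeroDivisors R
  iso : Nonempty (I ≃ₗ[R] (I →ₗ[R] I))

section Conductor

variable {R : Type u} [CommRing R] {Q : Type v} [CommRing Q] [Algebra R Q]

/-- The conductor `(R :_Q S) = {a ∈ Q | a S ⊆ R}` of `S` in `R`, as an ideal of `R`; here
`1 : Submodule R Q` is the image of `R` in `Q`. See `map_birationalConductor`. -/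
def birationalConductor (S : Subalgebra R Q) : Ideal R :=
  ((1 : Submodule R Q) / Subalgebra.toSubmodule S).comap (Algebra.linearMap R Q)

/-- All of `(R :_Q S)` lies in the image of `R`, so nothing is lost in the pullback to `R`. -/
theorem map_birationalConductor (S : Subalgebra R Q) :
    Submodule.map (Algebra.linearMap R Q) (birationalConductor S) =
      (1 : Submodule R Q) / Subalgebra.toSubmodule S := by
  rw [birationalConductor, Submodule.map_comap_eq, inf_eq_right, ← Submodule.one_eq_range]
  intro a ha
  have h := Submodule.mem_div_iff_forall_mul_mem.1 ha 1 (one_mem S)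
  rwa [mul_one] at h

end Conductor

/-!
The residue field of a one-dimensional Gorenstein local ring `R` embeds in `R` or in `R ⧸ (x)` with
`x` regular. Neither has extensions by `R` in degrees above one, so dévissage and descending
induction bring the finite injective dimension of `R` down to at most one.

A module has injective dimension at most one exactly when linear maps to it extend from the kernel
of any map to a free module. For `R` this makes every finitely generated module surject onto its
double dual, so that `(R : (R : F)) = F` for a finitely generated submodule `F` of `Q` containing a
unit.

Put `C = (R :_Q S)`. Multiplication identifies `Hom_R(S, R)` with `C` and `Hom_R(C, C)` with
`(C : C) = (R : C S) = (R : (R : S)) = S`. Hence `C` is stable exactly when `S ≅ C`.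

If `S` is Gorenstein, then `(S : C (S : C)) = (C : C) = S` by reflexivity over `S`, and again by
reflexivity `C (S : C) = S`: the `S`-module `C` is invertible, hence free because `S` is semilocal.

Conversely, an isomorphism `S ≅ Hom_R(S, R)` is a nondegenerate trace form `τ : S → R`, and `τ`
transfers the extension property above from `R` to `S`.
-/

section Ext

open Abelian

section ShortExact

variable {C : Type*} [Category* C] [Abelian C] [HasExt.{v} C] {S : ShortComplex C}

theorem subsingleton_ext_X₂ (hS : S.ShortExact) {Y : C} {n : ℕ}
    (h₁ : Subsingleton (Ext S.X₁ Y n)) (h₃ : Subsingleton (Ext S.X₃ Y n)) :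
    Subsingleton (Ext S.X₂ Y n) := by
  refine subsingleton_of_forall_eq 0 fun e => ?_
  obtain ⟨e', rfl⟩ := Ext.contravariant_sequence_exact₂ hS Y e (h₁.elim _ _)
  rw [h₃.elim e' 0, Ext.comp_zero]

theorem subsingleton_ext_X₁ (hS : S.ShortExact) {Y : C} {n : ℕ}
    (h₂ : Subsingleton (Ext S.X₂ Y n)) (h₃ : Subsingleton (Ext S.X₃ Y (n + 1))) :
    Subsingleton (Ext S.X₁ Y n) := by
  refine subsingleton_of_forall_eq 0 fun e => ?_
  obtain ⟨e', rfl⟩ := Ext.contravariant_sequence_exact₁ hS Y e (add_comm 1 n) (h₃.elim _ _)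
  rw [h₂.elim e' 0, Ext.comp_zero]

theorem subsingleton_ext_X₃ (hS : S.ShortExact) {Y : C} {n : ℕ}
    (h₁ : Subsingleton (Ext S.X₁ Y n)) (h₂ : Subsingleton (Ext S.X₂ Y (n + 1))) :
    Subsingleton (Ext S.X₃ Y (n + 1)) := by
  refine subsingleton_of_forall_eq 0 fun e => ?_
  obtain ⟨e', rfl⟩ := Ext.contravariant_sequence_exact₃ hS Y e (h₂.elim _ _) (add_comm 1 n)
  rw [h₁.elim e' 0, Ext.comp_zero]

end ShortExact

section Module

variable {A : Type u} [CommRing A]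

theorem moduleCat_shortExact {M N P : Type u} [AddCommGroup M] [AddCommGroup N] [AddCommGroup P]
    [Module A M] [Module A N] [Module A P] {f : M →ₗ[A] N} {g : N →ₗ[A] P}
    (hf : Function.Injective f) (hg : Function.Surjective g) (hfg : Function.Exact f g) :
    (ModuleCat.shortComplexOfCompEqZero f g hfg.linearMap_comp_eq_zero).ShortExact :=
  ModuleCat.shortComplex_shortExact _ hfg hf hg

theorem moduleCat_shortExact_mkQ {M N : Type u} [AddCommGroup M] [AddCommGroup N] [Module A M]
    [Module A N] {f : M →ₗ[A] N} (hf : Function.Injective f) :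
    (ModuleCat.shortComplexOfCompEqZero f (LinearMap.range f).mkQ
      f.exact_map_mkQ_range.linearMap_comp_eq_zero).ShortExact :=
  moduleCat_shortExact hf (Submodule.mkQ_surjective _) f.exact_map_mkQ_range

theorem hasInjectiveDimensionLE_of_subsingleton_ext_quotient {M : ModuleCat.{u} A} {n : ℕ}
    (h : ∀ I : Ideal A, Subsingleton (Ext (ModuleCat.of A (A ⧸ I)) M (n + 1))) :
    HasInjectiveDimensionLE M n := by
  induction n generalizing M with
  | zero =>
    rw [HasInjectiveDimensionLE, zero_add, ← injective_iff_hasInjectiveDimensionLT_one,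
      ← Module.injective_iff_injective_object, ← Module.Baer.iff_injective]
    intro I φ
    have hS := moduleCat_shortExact_mkQ I.subtype_injective
    have hI : Subsingleton (Ext (ModuleCat.of A (A ⧸ LinearMap.range I.subtype)) M 1) := by
      rw [I.range_subtype]
      exact h I
    obtain ⟨e, he⟩ := Ext.contravariant_sequence_exact₁ hS M (Ext.mk₀ (ModuleCat.ofHom φ))
      (add_comm 1 0) (hI.elim _ _)
    obtain ⟨ψ, rfl⟩ := (Ext.mk₀_bijective _ _).2 e
    rw [Ext.mk₀_comp_mk₀] at he
    have hψ := ModuleCat.hom_ext_iff.1 ((Ext.mk₀_bijective _ _).1 he)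
    exact ⟨ψ.hom, fun x hx => LinearMap.congr_fun hψ ⟨x, hx⟩⟩
  | succ n ih =>
    obtain ⟨E, _, f, _⟩ := EnoughInjectives.presentation M
    have hS : (ShortComplex.mk f (Limits.cokernel.π f) (Limits.cokernel.condition f)).ShortExact :=
      { exact := ShortComplex.exact_cokernel f }
    refine (hS.hasInjectiveDimensionLT_X₃_iff n ‹_›).1 (ih fun I => ?_)
    refine subsingleton_of_forall_eq 0 fun e => ?_
    obtain ⟨e', rfl⟩ := Ext.covariant_sequence_exact₃ _ hS e rfl ((h I).elim _ _)
    rw [Ext.eq_zero_of_injective e', Ext.zero_comp]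

theorem lsmul_quotient_injective {p : Ideal A} [p.IsPrime] {x : A} (hx : x ∉ p) :
    Function.Injective (LinearMap.lsmul A (A ⧸ p) x) := by
  rw [injective_iff_map_eq_zero]
  intro y hxy
  rw [LinearMap.lsmul_apply, Algebra.smul_def, mul_eq_zero] at hxy
  exact hxy.resolve_left (mt Ideal.Quotient.eq_zero_iff_mem.1 hx)

open IsLocalRing

variable [IsNoetherianRing A] [IsLocalRing A]

theorem subsingleton_ext_of_lsmul_injective {M N : ModuleCat.{u} A} [Module.Finite A M]
    [Module.Finite A N] {x : A} (hx : x ∈ maximalIdeal A)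
    (hinj : Function.Injective (LinearMap.lsmul A M x)) {n : ℕ}
    (h : Subsingleton
      (Ext (ModuleCat.of A (M ⧸ LinearMap.range (LinearMap.lsmul A M x))) N (n + 1))) :
    Subsingleton (Ext M N n) := by
  have hsurj (e : Ext M N n) : ∃ e', x • e' = e := by
    obtain ⟨e', he'⟩ := Ext.contravariant_sequence_exact₁ (moduleCat_shortExact_mkQ hinj) N e
      (add_comm 1 n) (h.elim _ _)
    have hmul : ModuleCat.ofHom (LinearMap.lsmul A M x) = x • 𝟙 M := rfl
    refine ⟨e', he' ▸ ?_⟩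
    change x • e' = (Ext.mk₀ (ModuleCat.ofHom (LinearMap.lsmul A M x))).comp e' _
    rw [hmul, Ext.mk₀_smul, Ext.smul_comp, Ext.mk₀_id_comp]
  have htop : (⊤ : Submodule A (Ext M N n)) = ⊥ := by
    refine Submodule.eq_bot_of_le_smul_of_le_jacobson_bot (maximalIdeal A) _
      Module.Finite.fg_top (fun e _ => ?_) (maximalIdeal_le_jacobson _)
    obtain ⟨e', rfl⟩ := hsurj e
    exact Submodule.smul_mem_smul hx trivial
  exact (Submodule.subsingleton_iff A).1 (subsingleton_of_bot_eq_top htop.symm)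

theorem subsingleton_ext_of_subsingleton_ext_residue {N : ModuleCat.{u} A} [Module.Finite A N]
    {n : ℕ}
    (h : ∀ (M : ModuleCat.{u} A) [Module.Finite A M], Subsingleton (Ext M N (n + 1)))
    (hk : Subsingleton (Ext (ModuleCat.of A (A ⧸ maximalIdeal A)) N n))
    (M : ModuleCat.{u} A) [Module.Finite A M] : Subsingleton (Ext M N n) := by
  suffices ∀ (M : Type u) [AddCommGroup M] [Module A M] [Module.Finite A M],
      Subsingleton (Ext (ModuleCat.of A M) N n) from this M
  intro M _ _ hM
  induction hM using IsNoetherianRing.induction_on_isQuotientEquivQuotientPrime A with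
  | subsingleton M =>
    have hM : Limits.IsZero (ModuleCat.of A M) := ModuleCat.isZero_of_subsingleton _
    have := hM.hasProjectiveDimensionLT_zero
    exact HasProjectiveDimensionLT.subsingleton _ 0 n n.zero_le N
  | exact M₁ M₂ M₃ f g hf hg hfg h₁ h₃ =>
    exact subsingleton_ext_X₂ (moduleCat_shortExact hf hg hfg) h₁ h₃
  | quotient M p e =>
    let eExt := ((extFunctor n).mapIso e.toModuleIso.op).app N
    suffices Subsingleton (Ext (ModuleCat.of A (A ⧸ p.1)) N n) from
      eExt.addCommGroupIsoToAddEquiv.subsingleton_congr.1 this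
    obtain hp | hp := eq_or_ne p.1 (maximalIdeal A)
    · rwa [hp]
    have := p.2
    obtain ⟨x, hxm, hxp⟩ := Set.not_subset.1 fun hle : maximalIdeal A ≤ p.1 =>
      hp ((maximalIdeal.isMaximal A).eq_of_le p.2.ne_top hle).symm
    exact subsingleton_ext_of_lsmul_injective (M := .of A (A ⧸ p.1)) hxm
      (lsmul_quotient_injective hxp) (h _)

theorem subsingleton_ext_residue_of_isAssociatedPrime {M N : ModuleCat.{u} A} [Module.Finite A M]
    {n : ℕ}
    (h : ∀ (M : ModuleCat.{u} A) [Module.Finite A M], Subsingleton (Ext M N (n + 1)))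
    (hM : IsAssociatedPrime (maximalIdeal A) M) (hMN : Subsingleton (Ext M N n)) :
    Subsingleton (Ext (ModuleCat.of A (A ⧸ maximalIdeal A)) N n) := by
  obtain ⟨-, f, hf⟩ := (isAssociatedPrime_iff_exists_injective_linearMap _ _).1 hM
  exact subsingleton_ext_X₁ (moduleCat_shortExact_mkQ hf) hMN (h (.of A (M ⧸ LinearMap.range f)))

theorem hasInjectiveDimensionLE_of_isAssociatedPrime_maximalIdeal {M N : ModuleCat.{u} A}
    [Module.Finite A M] [Module.Finite A N] {r : ℕ} [HasInjectiveDimensionLE N r]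
    (hM : IsAssociatedPrime (maximalIdeal A) M)
    {d : ℕ} (hMN : ∀ n > d, Subsingleton (Ext M N n)) : HasInjectiveDimensionLE N d := by
  suffices ∀ (X : ModuleCat.{u} A) [Module.Finite A X], Subsingleton (Ext X N (d + 1)) from
    hasInjectiveDimensionLE_of_subsingleton_ext_quotient fun I => this _
  refine Nat.decreasingInduction' (m := d + 1) (n := d + 1 + r) (P := fun n =>
    ∀ (X : ModuleCat.{u} A) [Module.Finite A X], Subsingleton (Ext X N n))
    (fun n _ hn h => ?_) (by lia) fun X _ => ?_
  · exact subsingleton_ext_of_subsingleton_ext_residue h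
      (subsingleton_ext_residue_of_isAssociatedPrime h hM (hMN n hn))
  · exact HasInjectiveDimensionLT.subsingleton N (r + 1) _ (by lia) X

end Module

end Ext

section Gorenstein

open Abelian IsLocalRing

variable {A : Type u} [CommRing A]

theorem isMaximal_of_mem_nonZeroDivisors [Ring.KrullDimLE 1 A] {x : A}
    (hx : x ∈ nonZeroDivisors A) {p : Ideal A} (hp : p.IsPrime) (hxp : x ∈ p) : p.IsMaximal :=
  (Ring.krullDimLE_one_iff.1 ‹_› p hp).resolve_left fun h =>
    Set.disjoint_left.1 (Ideal.disjoint_nonZeroDivisors_of_mem_minimalPrimes h) hxp hx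

theorem exists_mem_maximalIdeal_of_not_isAssociatedPrime [IsNoetherianRing A] [IsLocalRing A]
    (h : ¬ IsAssociatedPrime (maximalIdeal A) A) : ∃ x ∈ maximalIdeal A, x ∈ nonZeroDivisors A := by
  by_contra! hc
  obtain ⟨P, hP, hle⟩ := ((maximalIdeal A).subset_union_prime_finite (associatedPrimes.finite A A)
    (f := id) 0 0 fun _ h _ _ => h.isPrime).1 (by
      simp_rw [id, biUnion_associatedPrimes_eq_compl_nonZeroDivisors]
      exact hc)
  exact h ((maximalIdeal.isMaximal A).eq_of_le hP.isPrime.ne_top hle ▸ hP)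

theorem isAssociatedPrime_maximalIdeal_quotient [IsNoetherianRing A] [IsLocalRing A]
    [Ring.KrullDimLE 1 A] {x : A} (hx : x ∈ nonZeroDivisors A) {I : Ideal A} (hI : I ≠ ⊤)
    (hxI : x ∈ I) : IsAssociatedPrime (maximalIdeal A) (A ⧸ I) := by
  have := Ideal.Quotient.nontrivial_iff.2 hI
  obtain ⟨P, hP⟩ := associatedPrimes.nonempty A (A ⧸ I)
  have hxP : x ∈ P :=
    hP.annihilator_le (by rwa [Submodule.annihilator_top, Ideal.annihilator_quotient])
  exact eq_maximalIdeal (isMaximal_of_mem_nonZeroDivisors hx hP.isPrime hxP) ▸ hP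

theorem subsingleton_ext_quotient_span_singleton {x : A} (hx : x ∈ nonZeroDivisors A)
    (N : ModuleCat.{u} A) (n : ℕ) :
    Subsingleton (Ext (ModuleCat.of A (A ⧸ Ideal.span {x})) N (n + 2)) := by
  have hinj : Function.Injective (LinearMap.lsmul A A x) := fun a b hab =>
    (mul_cancel_left_mem_nonZeroDivisors hx).1 hab
  have hrange : LinearMap.range (LinearMap.lsmul A A x) = Ideal.span {x} := by
    ext a
    simp [Ideal.mem_span_singleton, dvd_def, eq_comm]
  have hA (k : ℕ) : Subsingleton (Ext (ModuleCat.of A A) N (k + 1)) :=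
    Ext.subsingleton_of_projective _ _ _
  rw [← hrange]
  exact subsingleton_ext_X₃ (moduleCat_shortExact_mkQ hinj) (hA n) (hA (n + 1))

theorem IsGorensteinLocalRing.hasInjectiveDimensionLE_one (hA : IsGorensteinLocalRing A)
    [Ring.KrullDimLE 1 A] : HasInjectiveDimensionLE (ModuleCat.of A A) 1 := by
  obtain ⟨_, _, r, _⟩ := hA
  by_cases hass : IsAssociatedPrime (maximalIdeal A) A
  · refine hasInjectiveDimensionLE_of_isAssociatedPrime_maximalIdeal (r := r) (M := .of A A) hass
      fun n hn => ?_
    obtain ⟨n, rfl⟩ := Nat.exists_eq_add_of_lt hn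
    exact Ext.subsingleton_of_projective _ _ _
  · obtain ⟨x, hxm, hx⟩ := exists_mem_maximalIdeal_of_not_isAssociatedPrime hass
    refine hasInjectiveDimensionLE_of_isAssociatedPrime_maximalIdeal (r := r)
      (M := .of A (A ⧸ Ideal.span {x})) (isAssociatedPrime_maximalIdeal_quotient hx
        (Ideal.span_singleton_ne_top hxm) (Ideal.mem_span_singleton_self x)) fun n hn => ?_
    obtain ⟨n, rfl⟩ := Nat.exists_eq_add_of_le' hn
    exact subsingleton_ext_quotient_span_singleton hx _ n

theorem krullDimLE_localizationAtPrime {n : ℕ} [Ring.KrullDimLE n A] (p : Ideal A) [p.IsPrime] :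
    Ring.KrullDimLE n (Localization.AtPrime p) := by
  rw [Ring.krullDimLE_iff, IsLocalization.AtPrime.ringKrullDim_eq_height p]
  exact Ideal.height_le_ringKrullDim_of_isPrime.trans (Ring.krullDimLE_iff.1 ‹_›)

theorem krullDimLE_of_isIntegral (A : Type*) {B : Type*} [CommRing A] [CommRing B] [Algebra A B]
    [Algebra.IsIntegral A B] {n : ℕ} [Ring.KrullDimLE n A] : Ring.KrullDimLE n B :=
  Ring.krullDimLE_iff.2 <| (Order.krullDim_le_of_strictMono (PrimeSpectrum.comap (algebraMap A B))
    fun _ _ h => Ideal.IsIntegral.comap_lt_comap h).trans (Ring.krullDimLE_iff.1 ‹_›)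

theorem hasInjectiveDimensionLE_localizedModule_iff (p : Ideal A) [p.IsPrime] (n : ℕ) :
    HasInjectiveDimensionLE ((ModuleCat.of A A).localizedModule p.primeCompl) n ↔
      HasInjectiveDimensionLE
        (ModuleCat.of (Localization.AtPrime p) (Localization.AtPrime p)) n := by
  suffices ∀ (M : ModuleCat.{u} A) (g : M →ₗ[A] Localization.AtPrime p)
      [IsLocalizedModule p.primeCompl g],
      HasInjectiveDimensionLE (M.localizedModule p.primeCompl) n ↔ HasInjectiveDimensionLE
        (ModuleCat.of (Localization.AtPrime p) (Localization.AtPrime p)) n from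
    this (.of A A) (Algebra.linearMap A (Localization.AtPrime p))
  intro M g _
  exact ModuleCat.hasInjectiveDimensionLE_iff_of_linearEquiv
    ((IsLocalizedModule.linearEquiv p.primeCompl (M.localizedModuleMkLinearMap p.primeCompl)
      g).extendScalarsOfIsLocalization p.primeCompl (Localization.AtPrime p)) n

theorem IsGorensteinRing.hasInjectiveDimensionLE_one (hA : IsGorensteinRing A)
    [Ring.KrullDimLE 1 A] : HasInjectiveDimensionLE (ModuleCat.of A A) 1 := by
  have := hA.isNoetherianRing
  rw [ModuleCat.hasInjectiveDimensionLE_iff_forall_maximalSpectrum]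
  intro m
  have := krullDimLE_localizationAtPrime (n := 1) m.1
  exact (hasInjectiveDimensionLE_localizedModule_iff m.1 1).2
    (hA.localization m.1).hasInjectiveDimensionLE_one

theorem isGorensteinRing_of_hasInjectiveDimensionLE [IsNoetherianRing A] {n : ℕ}
    [HasInjectiveDimensionLE (ModuleCat.of A A) n] : IsGorensteinRing A where
  isNoetherianRing := inferInstance
  localization m _ :=
    ⟨inferInstance, IsLocalization.isNoetherianRing m.primeCompl _ inferInstance, n,
      (hasInjectiveDimensionLE_localizedModule_iff m n).1
        (ModuleCat.localizedModule_hasInjectiveDimensionLE n m.primeCompl _)⟩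

theorem IsGorensteinLocalRing.isGorensteinRing (hA : IsGorensteinLocalRing A) :
    IsGorensteinRing A := by
  obtain ⟨_, _, n, _⟩ := hA
  exact isGorensteinRing_of_hasInjectiveDimensionLE (n := n)

end Gorenstein

section Extension

open Abelian

variable {A : Type u} [CommRing A]

theorem exists_extension_of_hasInjectiveDimensionLE_one {M : ModuleCat.{u} A}
    [HasInjectiveDimensionLE M 1] {K N F : Type*} [AddCommGroup K] [AddCommGroup N]
    [AddCommGroup F] [Module A K] [Module A N] [Module A F] [Module.Projective A F]
    {f : K →ₗ[A] N} {g : N →ₗ[A] F} (hf : Function.Injective f) (hfg : Function.Exact f g)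
    (φ : K →ₗ[A] M) : ∃ ψ : N →ₗ[A] M, ψ ∘ₗ f = φ := by
  obtain ⟨E, _, i, _⟩ := EnoughInjectives.presentation M
  have hi : Function.Injective i.hom := (ModuleCat.mono_iff_injective i).1 ‹_›
  have hE : Module.Baer A E := .of_injective (Module.injective_module_of_injective_object A E)
  let π := (LinearMap.range i.hom).mkQ
  have hiπ : Function.Exact i.hom π := i.hom.exact_map_mkQ_range
  have hE' : Module.Baer A (E ⧸ LinearMap.range i.hom) := by
    refine .of_injective ((Module.injective_iff_injective_object A _).2 ?_)
    exact injective_iff_hasInjectiveDimensionLT_one.2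
      (((moduleCat_shortExact_mkQ hi).hasInjectiveDimensionLT_X₃_iff 0 ‹_›).2 ‹_›)
  obtain ⟨α, hα⟩ := hE.extension_property f hf (i.hom ∘ₗ φ)
  have hker : LinearMap.ker g ≤ LinearMap.ker (π ∘ₗ α) := fun x hx => by
    obtain ⟨y, rfl⟩ := (hfg x).1 hx
    exact (congrArg π (LinearMap.congr_fun hα y)).trans (hiπ.apply_apply_eq_zero (φ y))
  obtain ⟨β, hβ⟩ := hE'.extension_property ((LinearMap.ker g).liftQ g le_rfl)
    (LinearMap.ker_eq_bot.1 (Submodule.ker_liftQ_eq_bot _ _ _ le_rfl))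
    ((LinearMap.ker g).liftQ (π ∘ₗ α) hker)
  obtain ⟨γ, hγ⟩ := Module.projective_lifting_property π β (Submodule.mkQ_surjective _)
  have hmem (x : N) : (α - γ ∘ₗ g) x ∈ LinearMap.range i.hom := by
    refine (hiπ _).1 ((map_sub π _ _).trans (sub_eq_zero.2 ?_))
    exact (LinearMap.congr_fun hβ (Submodule.Quotient.mk x)).symm.trans
      (LinearMap.congr_fun hγ (g x)).symm
  refine ⟨(LinearEquiv.ofInjective i.hom hi).symm ∘ₗ (α - γ ∘ₗ g).codRestrict _ hmem, ?_⟩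
  ext y
  rw [LinearMap.comp_apply, LinearMap.comp_apply, LinearEquiv.coe_coe, LinearEquiv.symm_apply_eq]
  refine Subtype.ext ?_
  simpa [hfg.apply_apply_eq_zero] using LinearMap.congr_fun hα y

theorem subsingleton_ext_one_of_exists_extension {M : ModuleCat.{u} A} {K P N : Type u}
    [AddCommGroup K] [AddCommGroup P] [AddCommGroup N] [Module A K] [Module A P] [Module A N]
    [Module.Projective A P] {f : K →ₗ[A] P} {g : P →ₗ[A] N} (hf : Function.Injective f)
    (hg : Function.Surjective g) (hfg : Function.Exact f g)
    (h : ∀ φ : K →ₗ[A] M, ∃ ψ : P →ₗ[A] M, ψ ∘ₗ f = φ) :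
    Subsingleton (Ext (ModuleCat.of A N) M 1) := by
  have hS := moduleCat_shortExact hf hg hfg
  refine subsingleton_of_forall_eq 0 fun e => ?_
  obtain ⟨e', rfl⟩ := Ext.contravariant_sequence_exact₃ hS M e
    ((Ext.subsingleton_of_projective (ModuleCat.of A P) _ _).elim _ _) (add_comm 1 0)
  obtain ⟨φ, rfl⟩ := (Ext.mk₀_bijective _ _).2 e'
  obtain ⟨ψ, hψ⟩ := h φ.hom
  obtain rfl : ModuleCat.ofHom f ≫ ModuleCat.ofHom ψ = φ := ModuleCat.hom_ext hψ
  rw [← Ext.mk₀_comp_mk₀]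
  exact hS.extClass_comp_assoc _

theorem hasInjectiveDimensionLE_one_of_exists_extension {M : ModuleCat.{u} A}
    (h : ∀ (P : Type u) [AddCommGroup P] [Module A P] [Module.Free A P] (g : P →ₗ[A] A)
      (φ : LinearMap.ker g →ₗ[A] M), ∃ ψ : P →ₗ[A] M, ψ ∘ₗ (LinearMap.ker g).subtype = φ) :
    HasInjectiveDimensionLE M 1 := by
  refine hasInjectiveDimensionLE_of_subsingleton_ext_quotient fun I => ?_
  let π : (I →₀ A) →ₗ[A] I := Finsupp.linearCombination A id
  have hπ : Function.Surjective π := Finsupp.linearCombination_id_surjective A I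
  let g : (I →₀ A) →ₗ[A] A := I.subtype ∘ₗ π
  have hg : Function.Exact (LinearMap.ker g).subtype π := fun x => by simp [g]
  have hI : Subsingleton (Ext (ModuleCat.of A I) M 1) :=
    subsingleton_ext_one_of_exists_extension (K := LinearMap.ker g)
      (LinearMap.ker g).subtype_injective hπ hg (h _ g)
  have hA : Subsingleton (Ext (ModuleCat.of A A) M 2) := Ext.subsingleton_of_projective _ _ _
  rw [← I.range_subtype]
  exact subsingleton_ext_X₃ (moduleCat_shortExact_mkQ I.subtype_injective) hI hA

end Extension

section Reflexive

variable {A : Type u} [CommRing A]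

theorem dual_eval_surjective_of_hasInjectiveDimensionLE_one [IsNoetherianRing A]
    [HasInjectiveDimensionLE (ModuleCat.of A A) 1] (M : Type*) [AddCommGroup M] [Module A M]
    [Module.Finite A M] : Function.Surjective (Module.Dual.eval A M) := by
  intro θ
  obtain ⟨n, p, hp⟩ := Module.Finite.exists_fin' A M
  obtain ⟨m, q, hq⟩ := Module.Finite.exists_fin' A (LinearMap.ker p)
  let r : (Fin m → A) →ₗ[A] (Fin n → A) := (LinearMap.ker p).subtype ∘ₗ q
  have hr : Function.Exact r p := by
    rw [LinearMap.exact_iff, LinearMap.range_comp_of_range_eq_top _ (LinearMap.range_eq_top.2 hq),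
      Submodule.range_subtype]
  have hdual : Function.Exact p.dualMap r.dualMap :=
    LinearMap.exact_lcomp_of_exact_of_surjective A hr hp
  obtain ⟨ψ, hψ⟩ := exists_extension_of_hasInjectiveDimensionLE_one (M := ModuleCat.of A A)
    (LinearMap.dualMap_injective_of_surjective hp) hdual θ
  obtain ⟨x, rfl⟩ := (Module.bijective_dual_eval A (Fin n → A)).2 ψ
  exact ⟨p x, hψ⟩

end Reflexive

section FractionRing

variable {A : Type u} [CommRing A] {Q : Type v} [CommRing Q] [Algebra A Q]

theorem submodule_div_div (I J K : Submodule A Q) : I / J / K = I / (J * K) :=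
  eq_of_forall_le_iff fun X => by
    rw [Submodule.le_div_iff_mul_le, Submodule.le_div_iff_mul_le, Submodule.le_div_iff_mul_le,
      mul_assoc, mul_comm K]

theorem submodule_one_div_one : (1 : Submodule A Q) / 1 = 1 :=
  eq_of_forall_le_iff fun X => by rw [Submodule.le_div_iff_mul_le, mul_one]

theorem one_div_toSubmodule_mul_toSubmodule (S : Subalgebra A Q) :
    1 / Subalgebra.toSubmodule S * Subalgebra.toSubmodule S = 1 / Subalgebra.toSubmodule S := by
  have hS : Subalgebra.toSubmodule S * Subalgebra.toSubmodule S = Subalgebra.toSubmodule S :=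
    S.isIdempotentElem_toSubmodule
  refine le_antisymm ?_ ?_
  · rw [Submodule.le_div_iff_mul_le, mul_assoc, hS, mul_comm]
    exact Submodule.mul_one_div_le_one
  · calc 1 / Subalgebra.toSubmodule S = 1 / Subalgebra.toSubmodule S * 1 := (mul_one _).symm
      _ ≤ _ := by gcongr; exact Submodule.one_le.2 S.one_mem

variable [IsFractionRing A Q] {F : Submodule A Q}

theorem linearMap_apply_mul_comm (φ : F →ₗ[A] Q) (x y : F) : φ x * y = φ y * x := by
  obtain ⟨⟨a, s⟩, hs⟩ := IsLocalization.surj (nonZeroDivisors A) (x : Q)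
  obtain ⟨⟨b, t⟩, ht⟩ := IsLocalization.surj (nonZeroDivisors A) (y : Q)
  dsimp only at hs ht
  have hxy : (b * s : A) • x = (a * t : A) • y := by
    ext
    simp only [Submodule.coe_smul, Algebra.smul_def, map_mul]
    linear_combination algebraMap A Q b * hs - algebraMap A Q a * ht
  have hφ := congrArg φ hxy
  simp only [map_smul, Algebra.smul_def, map_mul] at hφ
  refine (IsLocalization.map_units Q (s * t)).mul_left_cancel ?_
  simp only [Submonoid.coe_mul, map_mul]
  linear_combination hφ + algebraMap A Q s * φ x * ht - algebraMap A Q t * φ y * hs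

/-- The action of `(G :_Q F)` on `F` by multiplication. -/
def divToLinearMap (F G : Submodule A Q) : (G / F : Submodule A Q) →ₗ[A] (F →ₗ[A] G) where
  toFun q := (LinearMap.mulLeft A (q : Q)).restrict (Submodule.mem_div_iff_forall_mul_mem.1 q.2)
  map_add' _ _ := LinearMap.ext fun _ => Subtype.ext (add_mul _ _ _)
  map_smul' _ _ := LinearMap.ext fun _ => Subtype.ext (smul_mul_assoc _ _ _)

theorem divToLinearMap_bijective (G : Submodule A Q) {x : F} (hx : IsUnit (x : Q)) :
    Function.Bijective (divToLinearMap F G) := by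
  refine ⟨fun p q hpq => Subtype.ext (hx.mul_right_cancel ?_), fun φ => ?_⟩
  · exact congrArg Subtype.val (LinearMap.congr_fun hpq x)
  · obtain ⟨u, hu⟩ := hx
    have hφ (y : F) : (φ x : Q) * ↑u⁻¹ * y = φ y := by
      have hxy : (φ x : Q) * y = φ y * x := linearMap_apply_mul_comm (G.subtype ∘ₗ φ) x y
      rw [mul_right_comm, hxy, ← hu, Units.mul_inv_cancel_right]
    have hmem : (φ x : Q) * ↑u⁻¹ ∈ G / F := fun y hy => hφ ⟨y, hy⟩ ▸ (φ ⟨y, hy⟩).2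
    exact ⟨⟨_, hmem⟩, LinearMap.ext fun y => Subtype.ext (hφ y)⟩

/-- The dual of a submodule `F` of `Q` containing a unit is `(A :_Q F)`. -/
noncomputable def oneDivEquivDual {x : F} (hx : IsUnit (x : Q)) :
    (1 / F : Submodule A Q) ≃ₗ[A] (F →ₗ[A] A) :=
  (LinearEquiv.ofBijective _ (divToLinearMap_bijective 1 hx)).trans
    (LinearEquiv.congrRight ((LinearEquiv.ofEq _ _ Submodule.one_eq_range).trans
      (LinearEquiv.ofInjective (Algebra.linearMap A Q) (IsFractionRing.injective A Q)).symm))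

theorem algebraMap_oneDivEquivDual {x : F} (hx : IsUnit (x : Q)) (q : (1 / F : Submodule A Q))
    (y : F) : algebraMap A Q (oneDivEquivDual hx q y) = q * y :=
  LinearEquiv.ofInjective_symm_apply (f := Algebra.linearMap A Q)
    (h := IsFractionRing.injective A Q) _

theorem exists_isUnit_mem_one_div_of_fg (hF : F.FG) : ∃ d ∈ 1 / F, IsUnit d := by
  obtain ⟨d, hd, hdF⟩ := FractionalIdeal.isFractional_of_fg (S := nonZeroDivisors A) hF
  refine ⟨algebraMap A Q d, fun y hy => ?_, IsLocalization.map_units Q ⟨d, hd⟩⟩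
  rw [← Algebra.smul_def]
  exact Submodule.mem_one.2 (hdF y hy)

variable [IsNoetherianRing A] [HasInjectiveDimensionLE (ModuleCat.of A A) 1]

theorem submodule_one_div_one_div (hF : F.FG) {x : Q} (hxF : x ∈ F) (hx : IsUnit x) :
    1 / (1 / F) = F := by
  refine le_antisymm (fun t ht => ?_) (Submodule.le_div_iff_mul_le.2 Submodule.mul_one_div_le_one)
  have := Module.Finite.iff_fg.2 hF
  obtain ⟨d, hd, hdu⟩ := exists_isUnit_mem_one_div_of_fg hF
  let x' : F := ⟨x, hxF⟩
  let e := oneDivEquivDual (F := F) (x := x') hx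
  obtain ⟨y, hy⟩ := dual_eval_surjective_of_hasInjectiveDimensionLE_one F
    (oneDivEquivDual (F := 1 / F) (x := ⟨d, hd⟩) hdu ⟨t, ht⟩ ∘ₗ e.symm.toLinearMap)
  have hty := congrArg (algebraMap A Q) (LinearMap.congr_fun hy (e ⟨d, hd⟩))
  rw [LinearMap.comp_apply, LinearEquiv.coe_coe, e.symm_apply_apply, Module.Dual.eval_apply,
    algebraMap_oneDivEquivDual, algebraMap_oneDivEquivDual, mul_comm] at hty
  exact (hdu.mul_right_cancel hty : (y : Q) = t) ▸ y.2

theorem isUnit_of_div_self_eq_one (hF : F ≤ 1) {x : Q} (hxF : x ∈ F) (hx : IsUnit x)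
    (h : F / F = 1) : IsUnit F := by
  have hfg {G : Submodule A Q} (hG : G ≤ 1) : G.FG := by
    have : IsNoetherian A (1 : Submodule A Q) := by
      rw [Submodule.one_eq_range]
      infer_instance
    exact isNoetherian_submodule.1 this G hG
  refine IsUnit.of_mul_eq_one (1 / F) ?_
  have h1 : 1 / (F * (1 / F)) = 1 := by
    rw [mul_comm, ← submodule_div_div, submodule_one_div_one_div (hfg hF) hxF hx, h]
  obtain ⟨d, hd, hdu⟩ := exists_isUnit_mem_one_div_of_fg (hfg hF)
  rw [← submodule_one_div_one_div (hfg Submodule.mul_one_div_le_one) (Submodule.mul_mem_mul hxF hd)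
    (hx.mul hdu), h1, submodule_one_div_one]

end FractionRing

section Trace

theorem linearMap_dual_apply {R : Type*} [CommRing R] {Q : Type*} [CommRing Q] [Algebra R Q]
    [IsFractionRing R Q] {S : Subalgebra R Q} (f : S →ₗ[R] (S →ₗ[R] R)) (s t : S) :
    f s t = f 1 (s * t) := by
  obtain ⟨⟨a, r⟩, hr⟩ := IsLocalization.surj (nonZeroDivisors R) (s : Q)
  have hrs : (r : R) • s = algebraMap R S a := by
    refine Subtype.ext ?_
    rw [Subalgebra.coe_smul, Algebra.smul_def, mul_comm]
    exact hr
  refine (mul_cancel_left_mem_nonZeroDivisors r.2).1 ?_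
  calc (r : R) * f s t = f ((r : R) • s) t := by rw [map_smul, LinearMap.smul_apply, smul_eq_mul]
    _ = f 1 ((r : R) • s * t) := by
      rw [hrs, Algebra.algebraMap_eq_smul_one, map_smul, LinearMap.smul_apply, smul_one_mul,
        map_smul]
    _ = (r : R) * f 1 (s * t) := by rw [smul_mul_assoc, map_smul, smul_eq_mul]

variable {R : Type u} [CommRing R] [HasInjectiveDimensionLE (ModuleCat.of R R) 1]
  {S : Type v} [CommRing S] [Algebra R S]

theorem hasInjectiveDimensionLE_one_of_bijective_dual {F : Type*} [AddCommGroup F] [Module R F]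
    [Module.Projective R F] {i : S →ₗ[R] F} (hi : Function.Injective i) {τ : S →ₗ[R] R}
    (hτ : Function.Bijective fun s => τ ∘ₗ LinearMap.mulLeft R s) :
    HasInjectiveDimensionLE (ModuleCat.of S S) 1 := by
  refine hasInjectiveDimensionLE_one_of_exists_extension fun P _ _ _ g φ => ?_
  let := Module.compHom P (algebraMap R S)
  have : IsScalarTower R S P := .of_algebraMap_smul fun _ _ => rfl
  let g' : P →ₗ[R] F := i ∘ₗ g.restrictScalars R
  have hg' : Function.Exact ((LinearMap.ker g).subtype.restrictScalars R) g' := fun x => by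
    simp [g', map_eq_zero_iff i hi]
  obtain ⟨ψ, hψ⟩ := exists_extension_of_hasInjectiveDimensionLE_one (M := ModuleCat.of R R)
    (LinearMap.ker g).subtype_injective hg' (τ ∘ₗ φ.restrictScalars R)
  choose Ψ hΨ using fun x : P => hτ.2 (ψ ∘ₗ (LinearMap.toSpanSingleton S P x).restrictScalars R)
  replace hΨ (x : P) (s : S) : τ (Ψ x * s) = ψ (s • x) := LinearMap.congr_fun (hΨ x) s
  have heq {a b : S} (h : ∀ s, τ (a * s) = τ (b * s)) : a = b := hτ.1 (LinearMap.ext h)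
  refine ⟨⟨⟨Ψ, fun x y => heq fun s => ?_⟩, fun a x => heq fun s => ?_⟩,
    LinearMap.ext fun x => heq fun s => ?_⟩
  · rw [hΨ, smul_add, map_add, add_mul, map_add, hΨ, hΨ]
  · change τ (Ψ (a • x) * s) = τ (a * Ψ x * s)
    rw [hΨ, smul_smul, mul_comm a, mul_assoc, hΨ, mul_comm s]
  · change τ (Ψ x * s) = τ (φ x * s)
    rw [hΨ, mul_comm, ← smul_eq_mul, ← map_smul]
    exact LinearMap.congr_fun hψ (s • x)

end Trace

section Birational

theorem finite_maximalSpectrum_of_finite (R S : Type*) [CommRing R] [CommRing S] [Algebra R S]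
    [Module.Finite R S] [Finite (MaximalSpectrum R)] : Finite (MaximalSpectrum S) := by
  have hfin : (⋃ m : MaximalSpectrum R, m.asIdeal.primesOver S).Finite :=
    Set.finite_iUnion fun m => Algebra.QuasiFinite.finite_primesOver m.asIdeal
  have := hfin.to_subtype
  refine .of_injective (β := ⋃ m : MaximalSpectrum R, m.asIdeal.primesOver S)
    (fun n => ⟨n.asIdeal, Set.mem_iUnion.2 ⟨⟨n.asIdeal.comap (algebraMap R S), ?_⟩,
      n.isMaximal.isPrime, ⟨rfl⟩⟩⟩) fun m n h => MaximalSpectrum.ext (congrArg Subtype.val h)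
  have := n.isMaximal
  exact Ideal.isMaximal_comap_of_isIntegral_of_isMaximal n.asIdeal

variable {R : Type u} [CommRing R] {Q : Type v} [CommRing Q] [Algebra R Q]

theorem isFractionRing_subalgebra [IsFractionRing R Q] (S : Subalgebra R Q) :
    IsFractionRing S Q := by
  have hSQ : Function.Injective (algebraMap S Q) := Subtype.val_injective
  have hRS : Function.Injective (algebraMap R S) := fun a b h =>
    IsFractionRing.injective R Q (congrArg (algebraMap S Q) h)
  refine ⟨fun s => ?_, fun z => ?_, fun {s t} h => ⟨1, by rw [hSQ h]⟩⟩
  · obtain ⟨⟨a, r⟩, hr⟩ := IsLocalization.surj (nonZeroDivisors R) (s : Q)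
    have hs : s * algebraMap R S r = algebraMap R S a := hSQ hr
    have hrS : algebraMap R S r ∈ nonZeroDivisors S :=
      mem_nonZeroDivisors_of_injective hSQ (IsLocalization.map_units Q r).mem_nonZeroDivisors
    have ha : a ∈ nonZeroDivisors R :=
      mem_nonZeroDivisors_of_injective hRS (hs ▸ mul_mem s.2 hrS)
    exact isUnit_of_mul_isUnit_left (hr ▸ IsLocalization.map_units Q ⟨a, ha⟩)
  · obtain ⟨⟨a, r⟩, hr⟩ := IsLocalization.surj (nonZeroDivisors R) z
    have hrS : algebraMap R S r ∈ nonZeroDivisors S :=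
      mem_nonZeroDivisors_of_injective hSQ (IsLocalization.map_units Q r).mem_nonZeroDivisors
    exact ⟨(algebraMap R S a, ⟨_, hrS⟩), hr⟩

/-- The conductor `(R :_Q S)` as an `S`-submodule of `Q`. -/
def conductorSubmodule (S : Subalgebra R Q) : Submodule S Q :=
  { (1 : Submodule R Q) / Subalgebra.toSubmodule S with
    smul_mem' := fun s x hx => by
      rw [Algebra.smul_def, mul_comm]
      exact one_div_toSubmodule_mul_toSubmodule S ▸ Submodule.mul_mem_mul hx s.2 }

theorem mem_conductorSubmodule {S : Subalgebra R Q} {x : Q} :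
    x ∈ conductorSubmodule S ↔ x ∈ (1 : Submodule R Q) / Subalgebra.toSubmodule S :=
  Iff.rfl

theorem conductorSubmodule_le_one (S : Subalgebra R Q) : conductorSubmodule S ≤ 1 := fun x hx => by
  have h := Submodule.mem_div_iff_forall_mul_mem.1 (mem_conductorSubmodule.1 hx) 1 S.one_mem
  obtain ⟨a, ha⟩ := Submodule.mem_one.1 h
  exact Submodule.mem_one.2 ⟨algebraMap R S a, ha.trans (mul_one x)⟩

/-- The conductor ideal of `S` is isomorphic to its image `(R :_Q S)` in `Q`. -/
noncomputable def birationalConductorEquiv [IsFractionRing R Q] (S : Subalgebra R Q) :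
    birationalConductor S ≃ₗ[R] (1 / Subalgebra.toSubmodule S : Submodule R Q) :=
  (Submodule.equivMapOfInjective (Algebra.linearMap R Q) (IsFractionRing.injective R Q) _).trans
    (LinearEquiv.ofEq _ _ (map_birationalConductor S))

/-- The dual of `S` is the conductor `(R :_Q S)`. -/
noncomputable def conductorEquivDual [IsFractionRing R Q] (S : Subalgebra R Q) :
    (1 / Subalgebra.toSubmodule S : Submodule R Q) ≃ₗ[R] (S →ₗ[R] R) :=
  oneDivEquivDual (F := Subalgebra.toSubmodule S) (x := ⟨1, S.one_mem⟩) isUnit_one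

theorem algebraMap_conductorEquivDual [IsFractionRing R Q] {S : Subalgebra R Q}
    (q : (1 / Subalgebra.toSubmodule S : Submodule R Q)) (s : S) :
    algebraMap R Q (conductorEquivDual S q s) = q * s :=
  algebraMap_oneDivEquivDual _ _ _

variable [IsFractionRing R Q] (S : Subalgebra R Q) [Module.Finite R S]

theorem exists_isUnit_mem_one_div_toSubmodule :
    ∃ d ∈ (1 : Submodule R Q) / Subalgebra.toSubmodule S, IsUnit d :=
  exists_isUnit_mem_one_div_of_fg (Module.Finite.iff_fg.1 ‹Module.Finite R S›)

variable [IsNoetherianRing R] [HasInjectiveDimensionLE (ModuleCat.of R R) 1]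

theorem conductor_div_conductor :
    (1 / Subalgebra.toSubmodule S) / (1 / Subalgebra.toSubmodule S) =
      Subalgebra.toSubmodule S := by
  rw [submodule_div_div, mul_comm, one_div_toSubmodule_mul_toSubmodule]
  exact submodule_one_div_one_div (Module.Finite.iff_fg.1 ‹_›) S.one_mem isUnit_one

theorem isStableIdeal_birationalConductor_iff :
    IsStableIdeal (birationalConductor S) ↔ Nonempty (S ≃ₗ[R] (S →ₗ[R] R)) := by
  obtain ⟨d, hd, hdu⟩ := exists_isUnit_mem_one_div_toSubmodule S
  let e := birationalConductorEquiv S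
  let eEnd : S ≃ₗ[R] (birationalConductor S →ₗ[R] birationalConductor S) :=
    ((LinearEquiv.ofEq _ _ (conductor_div_conductor S).symm).trans
      (LinearEquiv.ofBijective _ (divToLinearMap_bijective _ (x := ⟨d, hd⟩) hdu))).trans
        (LinearEquiv.arrowCongr e e).symm
  refine ⟨fun h => ⟨(eEnd.trans h.iso.some.symm).trans (e.trans (conductorEquivDual S))⟩,
    fun ⟨f⟩ => ⟨?_, ⟨((e.trans (conductorEquivDual S)).trans f.symm).trans eEnd⟩⟩⟩
  refine ⟨e.symm ⟨d, hd⟩, (e.symm ⟨d, hd⟩).2, ?_⟩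
  refine mem_nonZeroDivisors_of_injective (IsFractionRing.injective R Q) ?_
  have h : algebraMap R Q (e.symm ⟨d, hd⟩) = d :=
    congrArg Subtype.val (e.apply_symm_apply ⟨d, hd⟩)
  rw [h]
  exact hdu.mem_nonZeroDivisors

theorem isGorensteinRing_of_equiv_dual (e : S ≃ₗ[R] (S →ₗ[R] R)) : IsGorensteinRing S := by
  obtain ⟨d, hd, hdu⟩ := exists_isUnit_mem_one_div_toSubmodule S
  let i : S →ₗ[R] R := conductorEquivDual S ⟨d, hd⟩
  have hi : Function.Injective i := fun s t hst => by
    have h := congrArg (algebraMap R Q) hst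
    rw [algebraMap_conductorEquivDual, algebraMap_conductorEquivDual] at h
    exact Subtype.ext (hdu.mul_left_cancel h)
  have hτ : Function.Bijective fun s => e 1 ∘ₗ LinearMap.mulLeft R s := by
    convert e.bijective using 2 with s
    exact LinearMap.ext fun t => (linearMap_dual_apply e.toLinearMap s t).symm
  have := hasInjectiveDimensionLE_one_of_bijective_dual hi hτ
  have := IsNoetherianRing.of_finite R S
  exact isGorensteinRing_of_hasInjectiveDimensionLE (n := 1)

theorem conductorSubmodule_div_self : conductorSubmodule S / conductorSubmodule S = 1 := by
  ext x
  calc x ∈ conductorSubmodule S / conductorSubmodule S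
      ↔ x ∈ (1 / Subalgebra.toSubmodule S) / (1 / Subalgebra.toSubmodule S) := Iff.rfl
    _ ↔ x ∈ Subalgebra.toSubmodule S := by rw [conductor_div_conductor]
    _ ↔ x ∈ (1 : Submodule S Q) := by
      rw [Submodule.mem_one, Subalgebra.mem_toSubmodule]
      exact ⟨fun h => ⟨⟨x, h⟩, rfl⟩, fun ⟨s, hs⟩ => hs ▸ s.2⟩

theorem nonempty_equiv_dual_of_isGorensteinRing [Ring.KrullDimLE 1 R]
    [Finite (MaximalSpectrum R)] (hS : IsGorensteinRing S) :
    Nonempty (S ≃ₗ[R] (S →ₗ[R] R)) := by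
  have := isFractionRing_subalgebra S
  have := hS.isNoetherianRing
  have := finite_maximalSpectrum_of_finite R S
  have := krullDimLE_of_isIntegral R (B := S) (n := 1)
  have := hS.hasInjectiveDimensionLE_one
  obtain ⟨d, hd, hdu⟩ := exists_isUnit_mem_one_div_toSubmodule S
  obtain ⟨C, hC⟩ := isUnit_of_div_self_eq_one (conductorSubmodule_le_one S)
    (mem_conductorSubmodule.2 hd) hdu (conductorSubmodule_div_self S)
  obtain ⟨e⟩ := Module.Invertible.free_iff_linearEquiv.1 (inferInstance : Module.Free S C)
  let eC : C ≃ₗ[R] (1 / Subalgebra.toSubmodule S : Submodule R Q) :=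
    LinearEquiv.ofEq (C.1.restrictScalars R) _ (by rw [hC]; rfl)
  exact ⟨((e.symm.restrictScalars R).trans eC).trans (conductorEquivDual S)⟩

end Birational

theorem mainTheorem6_general {R : Type u} [CommRing R] (hR : IsGorensteinRing R)
    [Ring.KrullDimLE 1 R] [Finite (MaximalSpectrum R)]
    {Q : Type v} [CommRing Q] [Algebra R Q] [IsFractionRing R Q]
    (S : Subalgebra R Q) [Module.Finite R S] :
    [IsGorensteinRing S,
      Nonempty (S ≃ₗ[R] (S →ₗ[R] R)),
      IsStableIdeal (birationalConductor S)].TFAE := by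
  have := hR.isNoetherianRing
  have := hR.hasInjectiveDimensionLE_one
  tfae_have 1 → 2 := nonempty_equiv_dual_of_isGorensteinRing S
  tfae_have 2 → 1 := fun ⟨e⟩ => isGorensteinRing_of_equiv_dual S e
  tfae_have 3 ↔ 2 := isStableIdeal_birationalConductor_iff S
  tfae_finish

theorem mainTheorem6 {R : Type u} [CommRing R] (hR : IsGorensteinLocalRing R)
    (hdim : ringKrullDim R = 1)
    {Q : Type v} [CommRing Q] [Algebra R Q] [IsFractionRing R Q]
    (S : Subalgebra R Q) (hS : Module.Finite R S) :
    [IsGorensteinRing S,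
      Nonempty (S ≃ₗ[R] (S →ₗ[R] R)),
      IsStableIdeal (birationalConductor S)].TFAE := by
  have := hR.isLocalRing
  have : Ring.KrullDimLE 1 R := Ring.krullDimLE_iff.2 (by rw [hdim]; rfl)
  exact mainTheorem6_general hR.isGorensteinRing S
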